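/- Let $d\ge 1$ be an integer. For a bounded set $A\subset\mathbb R^d$ and $r>0$ let $A_r=\{x\in\mathbb R^d:\inf_{a\in A}|x-a|\le r\}$ be its closed $r$-parallel set (with respect to the Euclidean norm), $\partial A_r$ its boundary, and $\mathcal H^{d-1}$ the $(d-1)$-dimensional Hausdorff measure on $\mathbb R^d$ (with $\mathcal H^{0}$ the counting measure). With $\kappa_t=\pi^{t/2}/\Gamma(1+\tfrac t2)$, the lower $s$-dimensional S-content of $A$ is $$\underline{\mathcal S}^s(A)=\liminf_{r\to 0+}\frac{\mathcal H^{d-1}(\partial A_r)}{(d-s)\,\kappa_{d-s}\,r^{d-1-s}}\quad(0\le s<d),\qquad \underline{\mathcal S}^d(A)=0,$$ and the lower S-dimension of $A$ is $\underline{\dim}_S A=\inf\{t\in[0,d]:\underline{\mathcal S}^t(A)=0\}$. **Proposition.** Let $F\subset\mathbb R$ be compact and nonempty, and let $d\ge 1$. Then $$\underline{\dim}_S\bigl(F\times[0,1]^{d-1}\bigr)=\underline{\dim}_S F+d-1,$$ where the lower S-dimension of $F\times[0,1]^{d-1}$ is taken in $\mathbb R^d$ and that of $F$ in $\mathbb R$.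 -/

import Mathlib

open MeasureTheory Filter Topology
open scoped ENNReal

noncomputable section

/-- The constant `κ_t = π ^ (t / 2) / Γ (1 + t / 2)`; for a natural number `t` this is the volume
of the unit ball of `ℝ ^ t`. -/
def ballConst (t : ℝ) : ℝ :=
  Real.pi ^ (t / 2) / Real.Gamma (1 + t / 2)

section SDimension

variable {E : Type*} [NormedAddCommGroup E] [InnerProductSpace ℝ E] [MeasurableSpace E]
  [BorelSpace E]

/-- The surface area `H^(d-1) (∂ A_r)` of the boundary of the closed `r`-parallel set
`A_r = {x | dist (x, A) ≤ r}` of a subset `A` of a Euclidean space of dimension `d ≥ 1`.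
Here `μHE[k]` is the `k`-dimensional Hausdorff measure, normalised so that it agrees with
Lebesgue measure on `ℝ ^ k`; `μHE[0]` is the counting measure. -/
def parallelSurfaceArea (A : Set E) (r : ℝ) : ℝ≥0∞ :=
  μHE[Module.finrank ℝ E - 1] (frontier (Metric.cthickening r A))

/-- The lower `s`-dimensional S-content of `A`, for `0 ≤ s ≤ d = dim E`: it is
`liminf_{r → 0+} H^(d-1) (∂ A_r) / ((d - s) κ_{d-s} r ^ (d-1-s))` if `s < d`, and `0` (by
convention) if `s = d`. The denominator is positive and finite for `0 ≤ s < d` and `r > 0`. -/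
def lowerSContent (s : ℝ) (A : Set E) : ℝ≥0∞ :=
  if s = (Module.finrank ℝ E : ℝ) then 0
  else
    liminf (fun r : ℝ =>
      parallelSurfaceArea A r /
        ENNReal.ofReal (((Module.finrank ℝ E : ℝ) - s) * ballConst ((Module.finrank ℝ E : ℝ) - s) *
          r ^ ((Module.finrank ℝ E : ℝ) - 1 - s))) (𝓝[>] (0 : ℝ))

/-- The lower S-dimension of `A`: the infimum of the `t ≥ 0` whose lower `t`-dimensional S-content
vanishes. The contents are defined for `0 ≤ t ≤ d`, where `d = dim E`; the set contains `t = d`. -/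
def lowerSDim (A : Set E) : ℝ :=
  sInf {t : ℝ | 0 ≤ t ∧ t ≤ (Module.finrank ℝ E : ℝ) ∧ lowerSContent t A = 0}

end SDimension

/-- The product `F × [0,1] ^ (d-1)` as a subset of the Euclidean space `ℝ ^ d`, `d ≥ 1`. -/
def prodUnitCube (d : ℕ) [NeZero d] (F : Set ℝ) : Set (EuclideanSpace ℝ (Fin d)) :=
  {x | x 0 ∈ F ∧ ∀ i : Fin d, i ≠ 0 → x i ∈ Set.Icc (0 : ℝ) 1}

end

noncomputable section

open Metric Set

/-! Write `d = n + 1`, let `N r` be the number of boundary points of `F_r` in the line, and let `S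
r` be the surface area of the parallel set of `F × [0,1]^n`. Everything rests on `N r ≤ S r ≤ N r +
C` for `0 < r ≤ 1`, with `C` independent of `r`.

Over the cube the boundary is `∂F_r × [0,1]^n`, of measure `N r` (`cylinder_frontier_subset`,
`euclideanHausdorffMeasure_cylinder`). What remains lies in the level set `∑ f_j (x_j)^2 = r^2` of
the distances to the factors, off the open cube. There some `f_j` is at least `r / (n + 1)`, so on
suitable sheets forgetting coordinate `j` is antilipschitz with a constant depending only on `n`. If
`j` is a cube direction, boundedly many sheets project into a fixed box; if `j` is the direction of
`F`, there are `O(1/r)` sheets, each projecting into a collar of volume `O(r)`. Both totals are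
bounded (`exists_euclideanHausdorffMeasure_cylinderLateral_le`).

The content denominators depend only on the codimension `u = d - s`. For `0 < u < 1` they tend to
infinity and absorb `C`; for `u ≥ 1` they stay bounded while `N r ≥ 1`, so neither content vanishes.
Hence the orders of vanishing content for the product are those for `F` shifted by `n`, and so are
their infima. -/

/-! ### Antilipschitz projections of level sets. -/

/-- If `π` is antilipschitz on `S`, then the measure of `S` is controlled by that of `π '' S`. -/
theorem euclideanHausdorffMeasure_le_mul_image {X Y : Type*} [MetricSpace X] [MeasurableSpace X]
    [BorelSpace X] [MetricSpace Y] [MeasurableSpace Y] [BorelSpace Y] (n : ℕ) {S : Set X}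
    (π : X → Y) (K : NNReal) (h : ∀ p ∈ S, ∀ q ∈ S, dist p q ≤ K * dist (π p) (π q)) :
    μHE[n] S ≤ (K : ℝ≥0∞) ^ n * μHE[n] (π '' S) := by
  rcases S.eq_empty_or_nonempty with rfl | ⟨x₀, -⟩
  · simp
  have : Nonempty X := ⟨x₀⟩
  have hinj : InjOn π S := by
    intro p hp q hq hpq
    have := h p hp q hq
    rw [hpq, dist_self, mul_zero] at this
    exact dist_le_zero.1 this
  have hlip : LipschitzOnWith K (Function.invFunOn π S) (π '' S) := by
    refine LipschitzOnWith.of_dist_le_mul ?_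
    rintro _ ⟨p, hp, rfl⟩ _ ⟨q, hq, rfl⟩
    rw [hinj.leftInvOn_invFunOn hp, hinj.leftInvOn_invFunOn hq]
    exact h p hp q hq
  have key := hlip.hausdorffMeasure_image_le (d := n) (Nat.cast_nonneg n)
  rw [hinj.invFunOn_image subset_rfl] at key
  simp only [Measure.euclideanHausdorffMeasure_def, Measure.smul_apply, ENNReal.smul_def,
    smul_eq_mul]
  rw [ENNReal.rpow_natCast] at key
  calc _ ≤ _ := mul_le_mul_right key _
    _ = _ := by ring

/-- The map that forgets the `i`-th coordinate. -/
def eraseCoord {n : ℕ} (i : Fin (n + 1)) (x : EuclideanSpace ℝ (Fin (n + 1))) :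
    EuclideanSpace ℝ (Fin n) :=
  WithLp.toLp 2 fun j => x (i.succAbove j)

theorem dist_sq_eq_eraseCoord {n : ℕ} (i : Fin (n + 1)) (x y : EuclideanSpace ℝ (Fin (n + 1))) :
    dist x y ^ 2 = (x i - y i) ^ 2 + dist (eraseCoord i x) (eraseCoord i y) ^ 2 := by
  rw [EuclideanSpace.dist_sq_eq, EuclideanSpace.dist_sq_eq, Fin.sum_univ_succAbove _ i]
  simp [eraseCoord, Real.dist_eq, sq_abs]

theorem abs_sub_le_dist_coord {n : ℕ} (x y : EuclideanSpace ℝ (Fin n)) (i : Fin n) :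
    |x i - y i| ≤ dist x y := by
  refine abs_le_of_sq_le_sq ?_ dist_nonneg
  rw [EuclideanSpace.dist_sq_eq]
  have := Finset.single_le_sum (f := fun j => dist (x j) (y j) ^ 2) (fun j _ => sq_nonneg _)
    (Finset.mem_univ i)
  simpa [Real.dist_eq, sq_abs] using this

/-- On a piece of the level set `∑ f_j (x_j) ^ 2 = r ^ 2` where `f_i` is bounded below by `c * r` and
expands distances, forgetting the `i`-th coordinate is antilipschitz. -/
theorem dist_le_mul_dist_eraseCoord {n : ℕ} {f : Fin (n + 1) → ℝ → ℝ} {c r : ℝ} (hc : 0 < c)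
    (hr : 0 < r) (hf0 : ∀ j t, 0 ≤ f j t) (hlip : ∀ j s t, |f j s - f j t| ≤ |s - t|)
    (i : Fin (n + 1)) {x y : EuclideanSpace ℝ (Fin (n + 1))}
    (hx : ∑ j, f j (x j) ^ 2 = r ^ 2) (hy : ∑ j, f j (y j) ^ 2 = r ^ 2)
    (hxi : c * r ≤ f i (x i)) (hyi : c * r ≤ f i (y i))
    (hxy : |x i - y i| ≤ |f i (x i) - f i (y i)|) :
    dist x y ≤ (n / c + 1) * dist (eraseCoord i x) (eraseCoord i y) := by
  set D := dist (eraseCoord i x) (eraseCoord i y) with hD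
  have hD0 : 0 ≤ D := dist_nonneg
  have hle : ∀ z : EuclideanSpace ℝ (Fin (n + 1)), ∑ j, f j (z j) ^ 2 = r ^ 2 →
      ∀ j, f j (z j) ≤ r := by
    intro z hz j
    refine abs_le_of_sq_le_sq' ?_ hr.le |>.2
    rw [← hz]
    exact Finset.single_le_sum (f := fun j => f j (z j) ^ 2) (fun j _ => sq_nonneg _)
      (Finset.mem_univ j)
  have hterm : ∀ j : Fin n, |f (i.succAbove j) (y (i.succAbove j)) ^ 2 -
      f (i.succAbove j) (x (i.succAbove j)) ^ 2| ≤ 2 * r * D := by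
    intro j
    have h1 := hle x hx (i.succAbove j)
    have h2 := hle y hy (i.succAbove j)
    have h3 := hf0 (i.succAbove j) (x (i.succAbove j))
    have h4 := hf0 (i.succAbove j) (y (i.succAbove j))
    have h5 : |f (i.succAbove j) (y (i.succAbove j)) - f (i.succAbove j) (x (i.succAbove j))| ≤ D := by
      rw [abs_sub_comm]
      refine (hlip _ _ _).trans ?_
      exact abs_sub_le_dist_coord (eraseCoord i x) (eraseCoord i y) j
    rw [sq_sub_sq, abs_mul, abs_of_nonneg (by positivity)]
    exact mul_le_mul (by linarith) h5 (abs_nonneg _) (by positivity)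
  have hsum : f i (x i) ^ 2 - f i (y i) ^ 2 = ∑ j : Fin n,
      (f (i.succAbove j) (y (i.succAbove j)) ^ 2 - f (i.succAbove j) (x (i.succAbove j)) ^ 2) := by
    rw [Fin.sum_univ_succAbove _ i] at hx hy
    rw [Finset.sum_sub_distrib]
    linarith
  have habs : |f i (x i) ^ 2 - f i (y i) ^ 2| ≤ n * (2 * r * D) := by
    rw [hsum]
    refine (Finset.abs_sum_le_sum_abs _ _).trans ?_
    refine (Finset.sum_le_sum fun j _ => hterm j).trans ?_
    simp
  have hcr : 0 < c * r := by positivity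
  have hfi : |f i (x i) - f i (y i)| ≤ n / c * D := by
    rw [sq_sub_sq, abs_mul, abs_of_nonneg (by linarith)] at habs
    have h6 : 2 * (c * r) * |f i (x i) - f i (y i)| ≤ n * (2 * r * D) :=
      (mul_le_mul_of_nonneg_right (by linarith) (abs_nonneg _)).trans habs
    rw [div_mul_eq_mul_div, le_div_iff₀ hc]
    have h7 : 2 * r * (|f i (x i) - f i (y i)| * c) ≤ 2 * r * (n * D) := by linarith
    exact le_of_mul_le_mul_left h7 (by positivity)
  have hxi' := hxy.trans hfi
  have hE : 0 ≤ (n : ℝ) / c * D := by positivity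
  refine abs_le_of_sq_le_sq' ?_ (by positivity) |>.2
  rw [dist_sq_eq_eraseCoord i, ← hD, ← sq_abs (x i - y i)]
  -- With `E = n / c * D`, this is `E^2 + D^2 ≤ (E + D)^2`.
  nlinarith [abs_nonneg (x i - y i), mul_nonneg hE hD0, pow_le_pow_left₀ (abs_nonneg _) hxi' 2]

/-! ### Parallel sets of products, boxes and collars. -/

/-- The parallel set of a product of compact sets, in terms of the distances to the factors. -/
theorem mem_cthickening_pi {ι : Type*} [Fintype ι] {C : ι → Set ℝ} (hC : ∀ i, IsCompact (C i))
    (hne : ∀ i, (C i).Nonempty) {r : ℝ} (hr : 0 ≤ r) (x : EuclideanSpace ℝ ι) :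
    x ∈ cthickening r {x : EuclideanSpace ℝ ι | ∀ i, x i ∈ C i} ↔
      ∑ i, infDist (x i) (C i) ^ 2 ≤ r ^ 2 := by
  have hAne : {x : EuclideanSpace ℝ ι | ∀ i, x i ∈ C i}.Nonempty := by
    choose a ha using hne
    exact ⟨WithLp.toLp 2 a, ha⟩
  have hAc : IsClosed {x : EuclideanSpace ℝ ι | ∀ i, x i ∈ C i} := by
    simp only [ofPred_forall]
    exact isClosed_iInter fun i => (hC i).isClosed.preimage (by fun_prop)
  rw [hAc.cthickening_eq_biUnion_closedBall hr]
  simp only [mem_iUnion, exists_prop, mem_closedBall]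
  constructor
  · rintro ⟨a, ha, hxa⟩
    refine le_trans ?_ (pow_le_pow_left₀ dist_nonneg hxa 2)
    rw [EuclideanSpace.dist_sq_eq]
    exact Finset.sum_le_sum fun i _ => pow_le_pow_left₀ infDist_nonneg (infDist_le_dist_of_mem (ha i)) 2
  · intro h
    choose a ha hxa using fun i => (hC i).exists_infDist_eq_dist (hne i) (x i)
    refine ⟨WithLp.toLp 2 a, ha, ?_⟩
    refine abs_le_of_sq_le_sq' ?_ hr |>.2
    rw [EuclideanSpace.dist_sq_eq]
    simpa [hxa] using h

theorem volume_pi_Icc (n : ℕ) {a b : ℝ} (hab : a ≤ b) :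
    volume {z : EuclideanSpace ℝ (Fin n) | ∀ j, z j ∈ Icc a b} = ENNReal.ofReal ((b - a) ^ n) := by
  have : {z : EuclideanSpace ℝ (Fin n) | ∀ j, z j ∈ Icc a b} =
      (@WithLp.ofLp 2 (Fin n → ℝ)) ⁻¹' (univ.pi fun _ => Icc a b) := by
    ext z; simp only [mem_preimage, mem_univ_pi, mem_ofPred_eq]
  rw [this, (PiLp.volume_preserving_ofLp (Fin n)).measure_preimage
    (MeasurableSet.univ_pi fun _ => measurableSet_Icc).nullMeasurableSet, volume_pi_pi]
  simp [ENNReal.ofReal_pow (sub_nonneg.2 hab)]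

/-- The set of points at coordinatewise distance at most `r` from the boundary of the unit cube,
outside its interior. -/
def cubeCollar (n : ℕ) (r : ℝ) : Set (EuclideanSpace ℝ (Fin n)) :=
  {z | (∀ j, z j ∈ Icc (-r) (1 + r)) ∧ ¬ ∀ j, z j ∈ Ioo (0 : ℝ) 1}

theorem volume_cubeCollar_le (n : ℕ) {r : ℝ} (hr : 0 < r) (hr1 : r ≤ 1) :
    volume (cubeCollar n r) ≤ ENNReal.ofReal (3 ^ n * r) := by
  have : cubeCollar n r =
      (@WithLp.ofLp 2 (Fin n → ℝ)) ⁻¹' ((univ.pi fun _ => Icc (-r) (1 + r)) \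
        univ.pi fun _ => Ioo 0 1) := by
    ext z; simp only [cubeCollar, mem_preimage, mem_univ_pi, mem_ofPred_eq, Set.mem_sdiff]
  have hm : MeasurableSet (univ.pi fun _ : Fin n => Ioo (0 : ℝ) 1) :=
    MeasurableSet.univ_pi fun _ => measurableSet_Ioo
  have hv : volume (univ.pi fun _ : Fin n => Ioo (0 : ℝ) 1) = 1 := by
    rw [volume_pi_pi]; simp
  rw [this, (PiLp.volume_preserving_ofLp (Fin n)).measure_preimage
    ((MeasurableSet.univ_pi fun _ => measurableSet_Icc).diff hm).nullMeasurableSet,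
    measure_sdiff _ hm.nullMeasurableSet (by rw [hv]; simp), hv, volume_pi_pi]
  · simp only [Real.volume_Icc, Finset.prod_const, Finset.card_univ, Fintype.card_fin]
    rw [← ENNReal.ofReal_pow (by linarith), ← ENNReal.ofReal_one,
      ← ENNReal.ofReal_sub _ zero_le_one]
    apply ENNReal.ofReal_le_ofReal
    -- Convexity of the power on `[1, 3]`, as `1 + 2r = (1 - r) * 1 + r * 3`, makes the excess over
    -- `1` linear in `r`.
    have h := (convexOn_pow (𝕜 := ℝ) n).2 (show (1 : ℝ) ∈ Ici 0 by simp)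
      (show (3 : ℝ) ∈ Ici 0 by simp) (show 0 ≤ 1 - r by linarith) hr.le (by ring)
    simp only [smul_eq_mul, one_pow] at h
    have e : (1 - r) * 1 + r * 3 = 1 + r - -r := by ring
    rw [e] at h
    linarith
  · exact pi_mono fun _ _ t ht => ⟨by linarith [ht.1], by linarith [ht.2]⟩

/-! ### Distance functions on the line. -/

theorem infDist_unitInterval_of_one_le {t : ℝ} (ht : 1 ≤ t) : infDist t (Icc (0 : ℝ) 1) = t - 1 := by
  refine le_antisymm ?_ ((le_infDist ⟨0, by simp⟩).2 fun y hy => ?_)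
  · refine (infDist_le_dist_of_mem (y := 1) (by simp)).trans ?_
    rw [Real.dist_eq, abs_of_nonneg (by linarith)]
  · rw [Real.dist_eq]
    exact le_trans (by linarith [hy.2]) (le_abs_self _)

theorem infDist_unitInterval_of_nonpos {t : ℝ} (ht : t ≤ 0) : infDist t (Icc (0 : ℝ) 1) = -t := by
  refine le_antisymm ?_ ((le_infDist ⟨0, by simp⟩).2 fun y hy => ?_)
  · refine (infDist_le_dist_of_mem (y := 0) (by simp)).trans ?_
    rw [Real.dist_eq, abs_of_nonpos (by linarith)]
    linarith
  · rw [Real.dist_eq]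
    exact le_trans (by linarith [hy.1]) (neg_le_abs _)

theorem mem_Icc_of_infDist_unitInterval_le {t r : ℝ} (hr : 0 ≤ r)
    (h : infDist t (Icc (0 : ℝ) 1) ≤ r) : t ∈ Icc (-r) (1 + r) := by
  constructor
  · by_contra! hc
    rw [infDist_unitInterval_of_nonpos (by linarith)] at h
    linarith
  · by_contra! hc
    rw [infDist_unitInterval_of_one_le (by linarith)] at h
    linarith

theorem abs_infDist_sub_infDist_le (A : Set ℝ) (s t : ℝ) : |infDist s A - infDist t A| ≤ |s - t| := by
  have := (lipschitz_infDist_pt A).dist_le_mul s t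
  simpa [Real.dist_eq] using this

/-- Two nearby points far from `F`, both having a nearest point of `F` on their left, have the same
nearest point. -/
theorem sub_eq_infDist_sub_infDist_left {F : Set ℝ} {δ x y : ℝ} (hδ : 0 < δ)
    (hxy : |x - y| ≤ δ) (hx : δ ≤ infDist x F) (hy : δ ≤ infDist y F)
    (hxF : x - infDist x F ∈ F) (hyF : y - infDist y F ∈ F) :
    x - y = infDist x F - infDist y F := by
  -- The nearest point `b` of `v` cannot lie to the right of `u`: then `|u - b| ≤ |u - v| - infDist
  -- v F ≤ 0`, against `infDist u F ≥ δ`. So `b` is a competitor on the left of `u`.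
  have key : ∀ u v : ℝ, |u - v| ≤ δ → δ ≤ infDist u F → δ ≤ infDist v F →
      v - infDist v F ∈ F → v - infDist v F ≤ u - infDist u F := by
    intro u v huv hu hv hvF
    by_contra! hlt
    have h := infDist_le_dist_of_mem (x := u) hvF
    rw [Real.dist_eq] at h
    have := abs_le.1 huv
    rcases le_abs.1 h with h | h <;> linarith
  have h1 := key x y hxy hx hy hyF
  have h2 := key y x (by rwa [abs_sub_comm]) hy hx hxF
  linarith

/-- Two nearby points far from `F`, both having a nearest point of `F` on their right, have the same
nearest point. -/
theorem sub_eq_infDist_sub_infDist_right {F : Set ℝ} {δ x y : ℝ} (hδ : 0 < δ)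
    (hxy : |x - y| ≤ δ) (hx : δ ≤ infDist x F) (hy : δ ≤ infDist y F)
    (hxF : x + infDist x F ∈ F) (hyF : y + infDist y F ∈ F) :
    y - x = infDist x F - infDist y F := by
  have key : ∀ u v : ℝ, |u - v| ≤ δ → δ ≤ infDist u F → δ ≤ infDist v F →
      v + infDist v F ∈ F → u + infDist u F ≤ v + infDist v F := by
    intro u v huv hu hv hvF
    by_contra! hlt
    have h := infDist_le_dist_of_mem (x := u) hvF
    rw [Real.dist_eq] at h
    have := abs_le.1 huv
    rcases le_abs.1 h with h | h <;> linarith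
  have h1 := key x y hxy hx hy hyF
  have h2 := key y x (by rwa [abs_sub_comm]) hy hx hxF
  linarith

/-! ### Sheets covering the lateral part, and its bounded area. -/

/-- The factors of `F × [0,1] ^ n`. -/
def cylinderFactor {n : ℕ} (F : Set ℝ) : Fin (n + 1) → Set ℝ :=
  Fin.cons F fun _ => Icc 0 1

/-- The level set of the distance function of `F × [0,1] ^ n`. -/
def cylinderLevelSet (n : ℕ) (F : Set ℝ) (r : ℝ) : Set (EuclideanSpace ℝ (Fin (n + 1))) :=
  {x | ∑ j, infDist (x j) (cylinderFactor F j) ^ 2 = r ^ 2}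

/-- The lateral part of the level set, lying over the complement of the interior of the cube. -/
def cylinderLateral (n : ℕ) (F : Set ℝ) (r : ℝ) : Set (EuclideanSpace ℝ (Fin (n + 1))) :=
  {x | x ∈ cylinderLevelSet n F r ∧ ¬ ∀ j : Fin n, x j.succ ∈ Ioo (0 : ℝ) 1}

theorem infDist_le_of_mem_cylinderLevelSet {n : ℕ} {F : Set ℝ} {r : ℝ} (hr : 0 ≤ r)
    {x : EuclideanSpace ℝ (Fin (n + 1))} (hx : x ∈ cylinderLevelSet n F r) (j : Fin (n + 1)) :
    infDist (x j) (cylinderFactor F j) ≤ r := by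
  refine abs_le_of_sq_le_sq' ?_ hr |>.2
  rw [← show _ = r ^ 2 from hx]
  exact Finset.single_le_sum (f := fun j => infDist (x j) (cylinderFactor F j) ^ 2)
    (fun j _ => sq_nonneg _) (Finset.mem_univ j)

/-- Otherwise the `n + 1` squares would sum to less than `r^2 / (n + 1)`. -/
theorem exists_le_infDist_of_mem_cylinderLevelSet {n : ℕ} {F : Set ℝ} {r : ℝ} (hr : 0 < r)
    {x : EuclideanSpace ℝ (Fin (n + 1))} (hx : x ∈ cylinderLevelSet n F r) :
    ∃ j, ((n : ℝ) + 1)⁻¹ * r ≤ infDist (x j) (cylinderFactor F j) := by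
  by_contra! h
  have hn : (0 : ℝ) < n + 1 := by positivity
  have h1 : ∑ j, infDist (x j) (cylinderFactor F j) ^ 2 <
      ∑ _j : Fin (n + 1), (((n : ℝ) + 1)⁻¹ * r) ^ 2 :=
    Finset.sum_lt_sum_of_nonempty Finset.univ_nonempty fun j _ =>
      pow_lt_pow_left₀ (h j) infDist_nonneg two_ne_zero
  rw [show _ = r ^ 2 from hx] at h1
  simp only [Finset.sum_const, Finset.card_univ, Fintype.card_fin, nsmul_eq_mul] at h1
  have h2 : ((n + 1 : ℕ) : ℝ) * (((n : ℝ) + 1)⁻¹ * r) ^ 2 = ((n : ℝ) + 1)⁻¹ * r ^ 2 := by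
    push_cast; field_simp
  rw [h2] at h1
  have h3 : ((n : ℝ) + 1)⁻¹ ≤ 1 := inv_le_one_of_one_le₀ (by linarith [(Nat.cast_nonneg n : (0:ℝ) ≤ n)])
  nlinarith [sq_nonneg r]

/-- The antilipschitz constant of the coordinate projections of the sheets. -/
def sheetConst (n : ℕ) : NNReal := n * (n + 1) + 1

/-- The measure of a sheet is controlled by that of its projection. -/
theorem euclideanHausdorffMeasure_sheet_le {n : ℕ} {F : Set ℝ} {r : ℝ} (hr : 0 < r)
    (i : Fin (n + 1)) {S : Set (EuclideanSpace ℝ (Fin (n + 1)))}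
    {T : Set (EuclideanSpace ℝ (Fin n))} (hS : S ⊆ cylinderLevelSet n F r)
    (hi : ∀ x ∈ S, ((n : ℝ) + 1)⁻¹ * r ≤ infDist (x i) (cylinderFactor F i))
    (hexp : ∀ x ∈ S, ∀ y ∈ S, |x i - y i| ≤
      |infDist (x i) (cylinderFactor F i) - infDist (y i) (cylinderFactor F i)|)
    (hT : ∀ x ∈ S, eraseCoord i x ∈ T) :
    μHE[n] S ≤ (sheetConst n : ℝ≥0∞) ^ n * volume T := by
  refine (euclideanHausdorffMeasure_le_mul_image n (eraseCoord i) (sheetConst n) ?_).trans ?_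
  · intro x hx y hy
    have := dist_le_mul_dist_eraseCoord (f := fun j t => infDist t (cylinderFactor F j))
      (c := ((n : ℝ) + 1)⁻¹) (by positivity) hr (fun _ _ => infDist_nonneg)
      (fun _ _ _ => abs_infDist_sub_infDist_le _ _ _) i (hS hx) (hS hy) (hi x hx) (hi y hy)
      (hexp x hx y hy)
    simpa [sheetConst] using this
  · rw [EuclideanSpace.euclideanHausdorffMeasure_eq_volume]
    gcongr
    rintro _ ⟨x, hx, rfl⟩
    exact hT x hx

/-- The sheets over the coordinate hyperplanes orthogonal to the cube directions. -/
def cubeSheet (n : ℕ) (F : Set ℝ) (r : ℝ) (i : Fin n) (J : Set ℝ) :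
    Set (EuclideanSpace ℝ (Fin (n + 1))) :=
  {x | x ∈ cylinderLevelSet n F r ∧
    ((n : ℝ) + 1)⁻¹ * r ≤ infDist (x i.succ) (cylinderFactor F i.succ) ∧ x i.succ ∈ J}

/-- The sheets over the cube, above an interval `J` and having nearest points of `F` in the
direction `σ`. -/
def baseSheet (n : ℕ) (F : Set ℝ) (r σ : ℝ) (J : Set ℝ) : Set (EuclideanSpace ℝ (Fin (n + 1))) :=
  {x | x ∈ cylinderLateral n F r ∧
    ((n : ℝ) + 1)⁻¹ * r ≤ infDist (x 0) F ∧ x 0 ∈ J ∧ x 0 + σ * infDist (x 0) F ∈ F}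

theorem mem_Icc_of_mem_cylinderLevelSet {n : ℕ} {F : Set ℝ} (hF : IsCompact F) (hne : F.Nonempty)
    {M : ℝ} (hM : 1 ≤ M) (hFM : F ⊆ Icc (-M) M) {r : ℝ} (hr : 0 < r) (hr1 : r ≤ 1)
    {x : EuclideanSpace ℝ (Fin (n + 1))} (hx : x ∈ cylinderLevelSet n F r) (j : Fin (n + 1)) :
    x j ∈ Icc (-(M + 1)) (M + 1) := by
  have h := infDist_le_of_mem_cylinderLevelSet hr.le hx j
  induction j using Fin.cases with
  | zero =>
    simp only [cylinderFactor, Fin.cons_zero] at h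
    obtain ⟨a, ha, hxa⟩ := hF.exists_infDist_eq_dist hne (x 0)
    rw [hxa, Real.dist_eq] at h
    have h1 := abs_le.1 h
    have h2 := hFM ha
    exact ⟨by linarith [h2.1], by linarith [h2.2]⟩
  | succ j =>
    simp only [cylinderFactor, Fin.cons_succ] at h
    have h1 := mem_Icc_of_infDist_unitInterval_le hr.le h
    exact ⟨by linarith [h1.1], by linarith [h1.2]⟩

theorem euclideanHausdorffMeasure_cubeSheet_le {n : ℕ} {F : Set ℝ} (hF : IsCompact F)
    (hne : F.Nonempty) {M : ℝ} (hM : 1 ≤ M) (hFM : F ⊆ Icc (-M) M) {r : ℝ} (hr : 0 < r)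
    (hr1 : r ≤ 1) (i : Fin n) {J : Set ℝ} (hJ : J = Iic 0 ∨ J = Ici 1) :
    μHE[n] (cubeSheet n F r i J) ≤
      (sheetConst n : ℝ≥0∞) ^ n * ENNReal.ofReal ((2 * (M + 1)) ^ n) := by
  have hT := volume_pi_Icc n (a := -(M + 1)) (b := M + 1) (by linarith)
  rw [show M + 1 - -(M + 1) = 2 * (M + 1) by ring] at hT
  rw [← hT]
  refine euclideanHausdorffMeasure_sheet_le hr i.succ (fun x hx => hx.1) (fun x hx => hx.2.1) ?_
    fun x hx j => mem_Icc_of_mem_cylinderLevelSet hF hne hM hFM hr hr1 hx.1 _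
  rintro x ⟨-, -, hxJ⟩ y ⟨-, -, hyJ⟩
  simp only [cylinderFactor, Fin.cons_succ]
  rcases hJ with rfl | rfl
  · rw [infDist_unitInterval_of_nonpos hxJ, infDist_unitInterval_of_nonpos hyJ, neg_sub_neg,
      abs_sub_comm]
  · rw [infDist_unitInterval_of_one_le hxJ, infDist_unitInterval_of_one_le hyJ,
      sub_sub_sub_cancel_right]

/-- On an interval no longer than the lower bound for the distance, all points share one nearest
point on the side `σ`, so the distance has slope `±1` there. Being off the open cube confines the
projection to a collar, which supplies the factor `r`. -/
theorem euclideanHausdorffMeasure_baseSheet_le {n : ℕ} {F : Set ℝ} {r : ℝ} (hr : 0 < r)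
    (hr1 : r ≤ 1) {σ : ℝ} (hσ : σ = 1 ∨ σ = -1) {J : Set ℝ}
    (hJ : ∀ s ∈ J, ∀ t ∈ J, |s - t| ≤ ((n : ℝ) + 1)⁻¹ * r) :
    μHE[n] (baseSheet n F r σ J) ≤
      (sheetConst n : ℝ≥0∞) ^ n * ENNReal.ofReal (3 ^ n * r) := by
  refine (euclideanHausdorffMeasure_sheet_le (T := cubeCollar n r) hr 0 (fun x hx => hx.1.1)
    (fun x hx => hx.2.1) ?_ ?_).trans (mul_le_mul_right (volume_cubeCollar_le n hr hr1) _)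
  · rintro x ⟨-, hx, hxJ, hxF⟩ y ⟨-, hy, hyJ, hyF⟩
    have hδ : 0 < ((n : ℝ) + 1)⁻¹ * r := by positivity
    simp only [cylinderFactor, Fin.cons_zero]
    rcases hσ with rfl | rfl
    · rw [← sub_eq_infDist_sub_infDist_right hδ (hJ _ hxJ _ hyJ) hx hy (by simpa using hxF)
        (by simpa using hyF), abs_sub_comm]
    · rw [← sub_eq_infDist_sub_infDist_left hδ (hJ _ hxJ _ hyJ) hx hy
        (by simpa [sub_eq_add_neg] using hxF) (by simpa [sub_eq_add_neg] using hyF)]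
  · rintro x ⟨hx, -⟩
    refine ⟨fun j => mem_Icc_of_infDist_unitInterval_le hr.le ?_, hx.2⟩
    exact infDist_le_of_mem_cylinderLevelSet hr.le hx.1 j.succ

/-- The `k`-th interval of the subdivision of the line into intervals of length `δ`. -/
def gridInterval (δ : ℝ) (k : ℤ) : Set ℝ := {t | ⌊t / δ⌋ = k}

theorem abs_sub_le_of_mem_gridInterval {δ : ℝ} (hδ : 0 < δ) {k : ℤ} {s t : ℝ}
    (hs : s ∈ gridInterval δ k) (ht : t ∈ gridInterval δ k) : |s - t| ≤ δ := by
  have h := Int.abs_sub_lt_one_of_floor_eq_floor (show ⌊s / δ⌋ = ⌊t / δ⌋ from hs.trans ht.symm)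
  rw [← sub_div, abs_div, abs_of_pos hδ, div_lt_one hδ] at h
  exact h.le

/-- Sort points by a coordinate whose distance is at least `r / (n + 1)`, then by the side of the
nearest point; boundedness of `F` leaves finitely many grid intervals. -/
theorem cylinderLateral_subset {n : ℕ} {F : Set ℝ} (hF : IsCompact F)
    (hne : F.Nonempty) {M : ℝ} (hM : 1 ≤ M) (hFM : F ⊆ Icc (-M) M) {r : ℝ} (hr : 0 < r)
    (hr1 : r ≤ 1) :
    cylinderLateral n F r ⊆
      (⋃ i ∈ (Finset.univ : Finset (Fin n)), cubeSheet n F r i (Iic 0) ∪ cubeSheet n F r i (Ici 1)) ∪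
      ⋃ k ∈ Finset.Icc ⌊-(M + 1) / (((n : ℝ) + 1)⁻¹ * r)⌋ ⌊(M + 1) / (((n : ℝ) + 1)⁻¹ * r)⌋,
        baseSheet n F r 1 (gridInterval (((n : ℝ) + 1)⁻¹ * r) k) ∪
          baseSheet n F r (-1) (gridInterval (((n : ℝ) + 1)⁻¹ * r) k) := by
  intro x hx
  have hδ : 0 < ((n : ℝ) + 1)⁻¹ * r := by positivity
  obtain ⟨j, hj⟩ := exists_le_infDist_of_mem_cylinderLevelSet hr hx.1
  induction j using Fin.cases with
  | zero =>
    right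
    simp only [cylinderFactor, Fin.cons_zero] at hj
    have hb := mem_Icc_of_mem_cylinderLevelSet hF hne hM hFM hr hr1 hx.1 0
    refine mem_biUnion (x := ⌊x 0 / (((n : ℝ) + 1)⁻¹ * r)⌋) ?_ ?_
    · rw [Finset.coe_Icc]
      exact ⟨Int.floor_le_floor (by gcongr; exact hb.1), Int.floor_le_floor (by gcongr; exact hb.2)⟩
    · obtain ⟨a, ha, hxa⟩ := hF.exists_infDist_eq_dist hne (x 0)
      rw [Real.dist_eq] at hxa
      rcases le_total (x 0) a with h | h
      · left
        refine ⟨hx, hj, rfl, ?_⟩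
        rw [hxa, abs_of_nonpos (by linarith)]
        convert ha using 1; ring
      · right
        refine ⟨hx, hj, rfl, ?_⟩
        rw [hxa, abs_of_nonneg (by linarith)]
        convert ha using 1; ring
  | succ j =>
    left
    refine mem_biUnion (x := j) (by simp) ?_
    rcases le_total (x j.succ) 0 with h | h
    · exact Or.inl ⟨hx.1, hj, h⟩
    · refine Or.inr ⟨hx.1, hj, ?_⟩
      by_contra hc
      simp only [cylinderFactor, Fin.cons_succ] at hj
      rw [infDist_zero_of_mem (show x j.succ ∈ Icc (0 : ℝ) 1 from ⟨h, (not_le.1 hc).le⟩)] at hj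
      linarith

/-- The lateral parts of the level sets have bounded measure. -/
theorem exists_euclideanHausdorffMeasure_cylinderLateral_le (n : ℕ) {F : Set ℝ} (hF : IsCompact F)
    (hne : F.Nonempty) : ∃ C : ℝ≥0∞, C ≠ ∞ ∧ ∀ r : ℝ, 0 < r → r ≤ 1 →
      μHE[n] (cylinderLateral n F r) ≤ C := by
  obtain ⟨M, hM, hFM⟩ : ∃ M : ℝ, 1 ≤ M ∧ F ⊆ Icc (-M) M := by
    obtain ⟨M, hM⟩ := hF.isBounded.subset_closedBall 0
    refine ⟨max M 1, le_max_right _ _, fun x hx => ?_⟩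
    have := hM hx
    rw [mem_closedBall, Real.dist_eq, sub_zero] at this
    exact abs_le.1 (this.trans (le_max_left _ _))
  set K : ℝ≥0∞ := (sheetConst n : ℝ≥0∞) ^ n with hK
  have hKtop : K ≠ ∞ := by simp [hK]
  refine ⟨n * (2 * (K * ENNReal.ofReal ((2 * (M + 1)) ^ n))) +
    2 * K * ENNReal.ofReal ((2 * (M + 1) * (n + 1) + 2) * 3 ^ n), ?_, ?_⟩
  · finiteness
  intro r hr hr1
  set δ := ((n : ℝ) + 1)⁻¹ * r with hδdef
  have hδ : 0 < δ := by positivity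
  refine (measure_mono (cylinderLateral_subset hF hne hM hFM hr hr1)).trans ?_
  refine (measure_union_le _ _).trans (add_le_add ?_ ?_)
  · refine (measure_biUnion_finset_le _ _).trans ?_
    refine (Finset.sum_le_sum fun i _ => (measure_union_le _ _).trans (add_le_add
      (euclideanHausdorffMeasure_cubeSheet_le hF hne hM hFM hr hr1 i (.inl rfl))
      (euclideanHausdorffMeasure_cubeSheet_le hF hne hM hFM hr hr1 i (.inr rfl)))).trans ?_
    rw [Finset.sum_const, Finset.card_univ, Fintype.card_fin, nsmul_eq_mul, ← two_mul]
  · refine (measure_biUnion_finset_le _ _).trans ?_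
    refine (Finset.sum_le_sum fun k _ => (measure_union_le _ _).trans (add_le_add
      (euclideanHausdorffMeasure_baseSheet_le hr hr1 (.inl rfl)
        fun s hs t ht => abs_sub_le_of_mem_gridInterval hδ hs ht)
      (euclideanHausdorffMeasure_baseSheet_le hr hr1 (.inr rfl)
        fun s hs t ht => abs_sub_le_of_mem_gridInterval hδ hs ht))).trans ?_
    rw [Finset.sum_const, nsmul_eq_mul, ← hK, ← two_mul, Int.card_Icc]
    -- The number of grid intervals is `O(1/r)`, which cancels the factor `r` of the collar volume.
    have hcard : ((⌊(M + 1) / δ⌋ + 1 - ⌊-(M + 1) / δ⌋).toNat : ℝ) * r ≤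
        2 * (M + 1) * (n + 1) + 2 := by
      have h1 := Int.floor_le ((M + 1) / δ)
      have h2 := Int.lt_floor_add_one (-(M + 1) / δ)
      have h0 : (0 : ℤ) ≤ ⌊(M + 1) / δ⌋ + 1 - ⌊-(M + 1) / δ⌋ := by
        have : ⌊-(M + 1) / δ⌋ ≤ ⌊(M + 1) / δ⌋ := Int.floor_le_floor (by gcongr; linarith)
        omega
      have h3 : ((⌊(M + 1) / δ⌋ + 1 - ⌊-(M + 1) / δ⌋).toNat : ℝ) =
          (⌊(M + 1) / δ⌋ + 1 - ⌊-(M + 1) / δ⌋ : ℤ) := by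
        exact_mod_cast Int.toNat_of_nonneg h0
      rw [h3]
      push_cast
      have h4 : (M + 1) / δ * r = (M + 1) * (n + 1) := by
        rw [hδdef]; field_simp
      have h5 : -(M + 1) / δ = -((M + 1) / δ) := neg_div _ _
      rw [h5] at h2 ⊢
      nlinarith
    rw [show (3 : ℝ) ^ n * r = r * 3 ^ n by ring, ← ENNReal.ofReal_natCast]
    rw [show ∀ a b : ℝ≥0∞, a * (2 * (K * b)) = 2 * K * (a * b) by intros; ring,
      ← ENNReal.ofReal_mul (by positivity), ← mul_assoc]
    gcongr

/-! ### Parallel sets over the cube, and the measure of cylinders. -/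

theorem mem_cthickening_iff_infDist_le {F : Set ℝ} (hne : F.Nonempty) {r : ℝ} (hr : 0 ≤ r) (y : ℝ) :
    y ∈ cthickening r F ↔ infDist y F ≤ r := by
  rw [mem_cthickening_iff, infDist, ENNReal.le_ofReal_iff_toReal_le (infEDist_ne_top hne) hr]

theorem prodUnitCube_eq (n : ℕ) (F : Set ℝ) :
    prodUnitCube (n + 1) F = {x | ∀ i, x i ∈ cylinderFactor F i} := by
  ext x
  simp only [prodUnitCube, cylinderFactor, mem_ofPred_eq, Fin.forall_fin_succ, Fin.cons_zero,
    Fin.cons_succ]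
  simp [Fin.succ_ne_zero]

theorem isCompact_cylinderFactor {n : ℕ} {F : Set ℝ} (hF : IsCompact F) (i : Fin (n + 1)) :
    IsCompact (cylinderFactor F i) := by
  induction i using Fin.cases with
  | zero => simpa [cylinderFactor] using hF
  | succ j => simpa [cylinderFactor] using isCompact_Icc

theorem cylinderFactor_nonempty {n : ℕ} {F : Set ℝ} (hne : F.Nonempty) (i : Fin (n + 1)) :
    (cylinderFactor F i).Nonempty := by
  induction i using Fin.cases with
  | zero => simpa [cylinderFactor] using hne
  | succ j => simp [cylinderFactor]

theorem mem_cthickening_prodUnitCube {n : ℕ} {F : Set ℝ} (hF : IsCompact F) (hne : F.Nonempty)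
    {r : ℝ} (hr : 0 ≤ r) (x : EuclideanSpace ℝ (Fin (n + 1))) :
    x ∈ cthickening r (prodUnitCube (n + 1) F) ↔
      ∑ i, infDist (x i) (cylinderFactor F i) ^ 2 ≤ r ^ 2 := by
  rw [prodUnitCube_eq]
  exact mem_cthickening_pi (isCompact_cylinderFactor hF) (cylinderFactor_nonempty hne) hr x

theorem mem_cthickening_prodUnitCube_of_mem_cube {n : ℕ} {F : Set ℝ} (hF : IsCompact F)
    (hne : F.Nonempty) {r : ℝ} (hr : 0 ≤ r) {x : EuclideanSpace ℝ (Fin (n + 1))}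
    (hx : ∀ j : Fin n, x j.succ ∈ Icc (0 : ℝ) 1) :
    x ∈ cthickening r (prodUnitCube (n + 1) F) ↔ x 0 ∈ cthickening r F := by
  rw [mem_cthickening_prodUnitCube hF hne hr, mem_cthickening_iff_infDist_le hne hr,
    Fin.sum_univ_succ]
  simp only [cylinderFactor, Fin.cons_zero, Fin.cons_succ]
  rw [Finset.sum_eq_zero fun j _ => by rw [infDist_zero_of_mem (hx j)]; simp, add_zero]
  exact pow_le_pow_iff_left₀ infDist_nonneg hr two_ne_zero

/-- The product `S × [0,1] ^ n`. -/
def unitCylinder (n : ℕ) (S : Set ℝ) : Set (EuclideanSpace ℝ (Fin (n + 1))) :=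
  {x | x 0 ∈ S ∧ ∀ j : Fin n, x j.succ ∈ Icc (0 : ℝ) 1}

theorem measurableSet_cylinder (n : ℕ) {S : Set ℝ} (hS : MeasurableSet S) :
    MeasurableSet (unitCylinder n S) := by
  have h : unitCylinder n S = (fun x : EuclideanSpace ℝ (Fin (n + 1)) => x 0) ⁻¹' S ∩
      ⋂ j : Fin n, (fun x : EuclideanSpace ℝ (Fin (n + 1)) => x j.succ) ⁻¹' Icc 0 1 := by
    ext x; simp only [unitCylinder, mem_ofPred_eq, mem_inter_iff, mem_iInter, mem_preimage]
  rw [h]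
  exact (hS.preimage (by fun_prop)).inter
    (MeasurableSet.iInter fun j => measurableSet_Icc.preimage (by fun_prop))

/-- Inserting a fixed first coordinate. -/
def consCoord {n : ℕ} (p : ℝ) (z : EuclideanSpace ℝ (Fin n)) : EuclideanSpace ℝ (Fin (n + 1)) :=
  WithLp.toLp 2 (Fin.cons p z)

theorem isometry_consCoord {n : ℕ} (p : ℝ) : Isometry (consCoord (n := n) p) := by
  refine Isometry.of_dist_eq fun z w => ?_
  rw [← sq_eq_sq₀ dist_nonneg dist_nonneg, EuclideanSpace.dist_sq_eq, EuclideanSpace.dist_sq_eq,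
    Fin.sum_univ_succ]
  simp [consCoord]

theorem euclideanHausdorffMeasure_cylinder_singleton (n : ℕ) (p : ℝ) :
    μHE[n] (unitCylinder n {p}) = 1 := by
  have h : unitCylinder n {p} =
      consCoord p '' {z : EuclideanSpace ℝ (Fin n) | ∀ j, z j ∈ Icc (0 : ℝ) 1} := by
    ext x
    constructor
    · rintro ⟨h0, hj⟩
      refine ⟨eraseCoord 0 x, hj, ?_⟩
      ext i
      induction i using Fin.cases with
      | zero => exact h0.symm
      | succ j => rfl
    · rintro ⟨z, hz, rfl⟩
      exact ⟨rfl, hz⟩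
  rw [h, (isometry_consCoord p).euclideanHausdorffMeasure_image,
    EuclideanSpace.euclideanHausdorffMeasure_eq_volume, volume_pi_Icc n zero_le_one]
  simp

theorem euclideanHausdorffMeasure_cylinder_finset (n : ℕ) (t : Finset ℝ) :
    μHE[n] (unitCylinder n (t : Set ℝ)) = t.card := by
  have h : unitCylinder n (t : Set ℝ) = ⋃ p ∈ t, unitCylinder n {p} := by
    ext x; simp [unitCylinder]
  rw [h, measure_biUnion_finset]
  · simp [euclideanHausdorffMeasure_cylinder_singleton]
  · intro p _ q _ hpq
    exact disjoint_left.2 fun x hp hq => hpq (hp.1.symm.trans hq.1)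
  · exact fun p _ => measurableSet_cylinder n (measurableSet_singleton p)

/-- An infinite `S` contains finite subsets of every cardinality, so no measurability is needed. -/
theorem euclideanHausdorffMeasure_cylinder (n : ℕ) (S : Set ℝ) :
    μHE[n] (unitCylinder n S) = Measure.count S := by
  by_cases hS : S.Finite
  · lift S to Finset ℝ using hS
    rw [euclideanHausdorffMeasure_cylinder_finset, Measure.count_apply_finset]
  · rw [Measure.count_apply_infinite hS]
    refine top_unique (le_of_tendsto' ENNReal.tendsto_nat_nhds_top fun m => ?_)
    obtain ⟨t, ht, rfl⟩ := Set.Infinite.exists_subset_card_eq hS m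
    rw [← euclideanHausdorffMeasure_cylinder_finset n]
    exact measure_mono fun x hx => ⟨ht hx.1, hx.2⟩

theorem euclideanHausdorffMeasure_zero_eq_count (S : Set ℝ) : μHE[0] S = Measure.count S := by
  have hfin : ∀ t : Finset ℝ, μHE[0] (t : Set ℝ) = t.card := by
    intro t
    rw [← sum_measure_singleton]
    simp
  by_cases hS : S.Finite
  · lift S to Finset ℝ using hS
    rw [hfin, Measure.count_apply_finset]
  · rw [Measure.count_apply_infinite hS]
    refine top_unique (le_of_tendsto' ENNReal.tendsto_nat_nhds_top fun m => ?_)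
    obtain ⟨t, ht, rfl⟩ := Set.Infinite.exists_subset_card_eq hS m
    rw [← hfin]
    exact measure_mono ht

theorem parallelSurfaceArea_real (F : Set ℝ) (r : ℝ) :
    parallelSurfaceArea F r = Measure.count (frontier (cthickening r F)) := by
  rw [parallelSurfaceArea, Module.finrank_self]
  exact euclideanHausdorffMeasure_zero_eq_count _

/-- Each line in the direction of `F` over a point of the closed cube meets the parallel set in a
copy of `F_r`, and the frontier of a continuous preimage lies in the preimage of the frontier. -/
theorem cylinder_frontier_subset {n : ℕ} {F : Set ℝ} (hF : IsCompact F) (hne : F.Nonempty) {r : ℝ}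
    (hr : 0 ≤ r) :
    unitCylinder n (frontier (cthickening r F)) ⊆ frontier (cthickening r (prodUnitCube (n + 1) F)) := by
  rintro x ⟨hx0, hx⟩
  have hc : Continuous fun y : ℝ => consCoord y (eraseCoord 0 x) := by
    refine (PiLp.continuous_toLp 2 _).comp (continuous_pi fun i => ?_)
    induction i using Fin.cases with
    | zero => exact continuous_id
    | succ j => exact continuous_const
  have hpre : (fun y : ℝ => consCoord y (eraseCoord 0 x)) ⁻¹'
      cthickening r (prodUnitCube (n + 1) F) = cthickening r F := by
    ext y
    exact mem_cthickening_prodUnitCube_of_mem_cube (x := consCoord y (eraseCoord 0 x)) hF hne hr hx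
  rw [← hpre] at hx0
  have := hc.frontier_preimage_subset _ hx0
  have hxx : consCoord (x 0) (eraseCoord 0 x) = x := by
    ext i
    induction i using Fin.cases with
    | zero => rfl
    | succ j => rfl
  rw [← hxx]
  exact this

theorem frontier_cthickening_prodUnitCube_subset {n : ℕ} {F : Set ℝ} (hF : IsCompact F)
    (hne : F.Nonempty) {r : ℝ} (hr : 0 ≤ r) :
    frontier (cthickening r (prodUnitCube (n + 1) F)) ⊆
      unitCylinder n (frontier (cthickening r F)) ∪ cylinderLateral n F r := by
  intro x hx
  have hlevel : x ∈ cylinderLevelSet n F r := by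
    have h : cthickening r (prodUnitCube (n + 1) F) = {x : EuclideanSpace ℝ (Fin (n + 1)) |
        ∑ i, infDist (x i) (cylinderFactor F i) ^ 2 ≤ r ^ 2} :=
      Set.ext (mem_cthickening_prodUnitCube hF hne hr)
    rw [h] at hx
    refine frontier_le_subset_eq ?_ continuous_const hx
    exact continuous_finsetSum _ fun i _ =>
      ((continuous_infDist_pt _).comp (by fun_prop)).pow 2
  by_cases hcube : ∀ j : Fin n, x j.succ ∈ Ioo (0 : ℝ) 1
  · left
    have hcube' : ∀ j : Fin n, x j.succ ∈ Icc (0 : ℝ) 1 := fun j => Ioo_subset_Icc_self (hcube j)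
    refine ⟨⟨?_, ?_⟩, hcube'⟩
    · exact subset_closure <| (mem_cthickening_prodUnitCube_of_mem_cube hF hne hr hcube').1
        (isClosed_cthickening.frontier_subset hx)
    · intro hint
      -- The neighbourhood `int F_r × (0,1)^n` lies in the parallel set; its openness is why the
      -- lateral part is taken off the open cube.
      refine hx.2 (mem_interior.2 ⟨(fun x : EuclideanSpace ℝ (Fin (n + 1)) => x 0) ⁻¹'
        interior (cthickening r F) ∩ ⋂ j : Fin n,
          (fun x : EuclideanSpace ℝ (Fin (n + 1)) => x j.succ) ⁻¹' Ioo 0 1, ?_, ?_, ?_⟩)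
      · rintro y ⟨hy0, hy⟩
        rw [mem_iInter] at hy
        exact (mem_cthickening_prodUnitCube_of_mem_cube hF hne hr
          fun j => Ioo_subset_Icc_self (hy j)).2 (interior_subset hy0)
      · exact (isOpen_interior.preimage (by fun_prop)).inter
          (isOpen_iInter_of_finite fun j => isOpen_Ioo.preimage (by fun_prop))
      · exact ⟨hint, mem_iInter.2 hcube⟩
  · exact Or.inr ⟨hlevel, hcube⟩

/-! ### Two-sided comparison of surface areas. -/

theorem parallelSurfaceArea_le_prodUnitCube {n : ℕ} {F : Set ℝ} (hF : IsCompact F)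
    (hne : F.Nonempty) {r : ℝ} (hr : 0 ≤ r) :
    parallelSurfaceArea F r ≤ parallelSurfaceArea (prodUnitCube (n + 1) F) r := by
  rw [parallelSurfaceArea_real, ← euclideanHausdorffMeasure_cylinder n, parallelSurfaceArea,
    finrank_euclideanSpace_fin, Nat.add_sub_cancel]
  exact measure_mono (cylinder_frontier_subset hF hne hr)

theorem exists_parallelSurfaceArea_prodUnitCube_le (n : ℕ) {F : Set ℝ} (hF : IsCompact F)
    (hne : F.Nonempty) : ∃ C : ℝ≥0∞, C ≠ ∞ ∧ ∀ r : ℝ, 0 < r → r ≤ 1 →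
      parallelSurfaceArea (prodUnitCube (n + 1) F) r ≤ parallelSurfaceArea F r + C := by
  obtain ⟨C, hC, h⟩ := exists_euclideanHausdorffMeasure_cylinderLateral_le n hF hne
  refine ⟨C, hC, fun r hr hr1 => ?_⟩
  rw [parallelSurfaceArea_real, ← euclideanHausdorffMeasure_cylinder n, parallelSurfaceArea,
    finrank_euclideanSpace_fin, Nat.add_sub_cancel]
  exact (measure_mono (frontier_cthickening_prodUnitCube_subset hF hne hr.le)).trans
    ((measure_union_le _ _).trans (by gcongr; exact h r hr hr1))

/-- By connectedness of the line, a nonempty bounded set has a boundary point. -/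
theorem one_le_parallelSurfaceArea_real {F : Set ℝ} (hF : IsCompact F) (hne : F.Nonempty) (r : ℝ) :
    1 ≤ parallelSurfaceArea F r := by
  have h : (frontier (cthickening r F)).Nonempty := by
    refine nonempty_frontier_iff.2 ⟨hne.mono (self_subset_cthickening F), fun huniv => ?_⟩
    have := hF.isBounded.cthickening (δ := r)
    rw [huniv] at this
    exact NoncompactSpace.noncompact_univ (X := ℝ)
      (isCompact_of_isClosed_isBounded isClosed_univ this)
  obtain ⟨x, hx⟩ := h
  rw [parallelSurfaceArea_real, ← Measure.count_singleton x]
  exact measure_mono (singleton_subset_iff.2 hx)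

/-! ### Contents and their vanishing. -/

theorem ballConst_pos {t : ℝ} (ht : 0 ≤ t) : 0 < ballConst t :=
  div_pos (Real.rpow_pos_of_pos Real.pi_pos _) (Real.Gamma_pos_of_pos (by linarith))

/-- The denominator in the definition of the S-content, in terms of the codimension `u = d - s`. -/
def contentDenom (u r : ℝ) : ℝ≥0∞ := ENNReal.ofReal (u * ballConst u * r ^ (u - 1))

theorem lowerSContent_real {t : ℝ} (ht : t ≠ 1) (F : Set ℝ) :
    lowerSContent t F =
      liminf (fun r => parallelSurfaceArea F r / contentDenom (1 - t) r) (𝓝[>] 0) := by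
  simp only [lowerSContent, Module.finrank_self, Nat.cast_one, if_neg ht, contentDenom]
  congr! 6
  ring

theorem lowerSContent_euclideanSpace {n : ℕ} {t : ℝ} (ht : t ≠ 1)
    (A : Set (EuclideanSpace ℝ (Fin (n + 1)))) :
    lowerSContent (t + n) A =
      liminf (fun r => parallelSurfaceArea A r / contentDenom (1 - t) r) (𝓝[>] 0) := by
  have h : t + n ≠ (n : ℝ) + 1 := fun h => ht (by linarith)
  simp only [lowerSContent, finrank_euclideanSpace_fin, Nat.cast_add, Nat.cast_one, if_neg h,
    contentDenom]
  have e : (n : ℝ) + 1 - (t + n) = 1 - t := by ring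
  have e' : (n : ℝ) + 1 - 1 - (t + n) = 1 - t - 1 := by ring
  rw [e, e']

/-- If the surface area is bounded below, then the content of order at most `d - 1` is positive. -/
theorem liminf_div_contentDenom_ne_zero {u : ℝ} (hu : 1 ≤ u) {N : ℝ → ℝ≥0∞}
    (hN : ∀ r, 0 < r → 1 ≤ N r) :
    liminf (fun r => N r / contentDenom u r) (𝓝[>] 0) ≠ 0 := by
  have hpos : 0 < u * ballConst u := mul_pos (by linarith) (ballConst_pos (by linarith))
  have hle : (ENNReal.ofReal (u * ballConst u))⁻¹ ≤
      liminf (fun r => N r / contentDenom u r) (𝓝[>] 0) := by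
    refine le_liminf_of_le (by isBoundedDefault) ?_
    filter_upwards [Ioc_mem_nhdsGT zero_lt_one] with r hr
    rw [← one_div]
    refine ENNReal.div_le_div (hN r hr.1) (ENNReal.ofReal_le_ofReal ?_)
    exact mul_le_of_le_one_right hpos.le (Real.rpow_le_one hr.1.le hr.2 (by linarith))
  intro h
  rw [h] at hle
  exact absurd (le_zero_iff.1 hle) (ENNReal.inv_ne_zero.2 ENNReal.ofReal_ne_top)

theorem tendsto_const_div_contentDenom {u : ℝ} (hu0 : 0 < u) (hu : u < 1) {C : ℝ≥0∞} (hC : C ≠ ∞) :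
    Tendsto (fun r => C / contentDenom u r) (𝓝[>] 0) (𝓝 0) := by
  have hpos : 0 < u * ballConst u := mul_pos hu0 (ballConst_pos hu0.le)
  have h1 : Tendsto (fun r => contentDenom u r) (𝓝[>] 0) (𝓝 ∞) := by
    refine ENNReal.tendsto_ofReal_nhds_top.2 ?_
    exact (tendsto_rpow_neg_nhdsGT_zero (by linarith)).const_mul_atTop hpos
  have := ENNReal.Tendsto.const_div (a := C) h1 (Or.inr hC)
  simpa using this

theorem lowerSContent_prodUnitCube_eq_zero_iff {n : ℕ} {F : Set ℝ} (hF : IsCompact F)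
    (hne : F.Nonempty) {t : ℝ} (ht0 : 0 ≤ t) (ht1 : t ≤ 1) :
    lowerSContent (t + n) (prodUnitCube (n + 1) F) = 0 ↔ lowerSContent t F = 0 := by
  rcases eq_or_ne t 1 with rfl | ht
  · simp [lowerSContent, add_comm]
  rw [lowerSContent_real ht, lowerSContent_euclideanSpace ht]
  constructor
  · intro h
    refine le_zero_iff.1 (le_trans (liminf_le_liminf ?_) h.le)
    filter_upwards [self_mem_nhdsWithin] with r hr
    exact ENNReal.div_le_div_right (parallelSurfaceArea_le_prodUnitCube hF hne (le_of_lt hr)) _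
  · intro h
    -- At `t = 0` the codimension is `1` and the denominator is constant, so `C` is not absorbed;
    -- there the content of `F` is positive anyway.
    rcases ht0.eq_or_lt with rfl | ht0
    · exact absurd h (liminf_div_contentDenom_ne_zero (by simp)
        fun r _ => one_le_parallelSurfaceArea_real hF hne r)
    obtain ⟨C, hC, hle⟩ := exists_parallelSurfaceArea_prodUnitCube_le n hF hne
    have hlim := tendsto_const_div_contentDenom (u := 1 - t)
      (sub_pos.2 (lt_of_le_of_ne ht1 ht)) (by linarith) hC
    rw [← ENNReal.liminf_add_of_right_tendsto_zero hlim] at h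
    refine le_zero_iff.1 (le_trans (liminf_le_liminf ?_) h.le)
    filter_upwards [Ioc_mem_nhdsGT zero_lt_one] with r hr
    simp only [Pi.add_apply]
    rw [← ENNReal.add_div]
    exact ENNReal.div_le_div_right (hle r hr.1 hr.2) _

/-- Orders below `n` have codimension above `1`, where surface area at least `1` forces positive
content. They have no counterpart `t ≥ 0` for `F`. -/
theorem le_of_lowerSContent_prodUnitCube_eq_zero {n : ℕ} {F : Set ℝ} (hF : IsCompact F)
    (hne : F.Nonempty) {s : ℝ} (hs : lowerSContent s (prodUnitCube (n + 1) F) = 0) :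
    (n : ℝ) ≤ s := by
  by_contra! h
  have e : s = (s - n) + n := by ring
  rw [e, lowerSContent_euclideanSpace (by intro h'; linarith)] at hs
  exact liminf_div_contentDenom_ne_zero (by linarith)
    (fun r hr => (one_le_parallelSurfaceArea_real hF hne r).trans
      (parallelSurfaceArea_le_prodUnitCube hF hne (le_of_lt hr))) hs

end

theorem mainTheorem8 (d : ℕ) [NeZero d] (F : Set ℝ) (hF : IsCompact F) (hne : F.Nonempty) :
    lowerSDim (prodUnitCube d F) = lowerSDim F + ((d : ℝ) - 1) := by
  obtain ⟨n, rfl⟩ := Nat.exists_eq_succ_of_ne_zero (NeZero.ne d)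
  have himage : {s : ℝ | 0 ≤ s ∧ s ≤ (Module.finrank ℝ (EuclideanSpace ℝ (Fin (n + 1))) : ℝ) ∧
        lowerSContent s (prodUnitCube (n + 1) F) = 0} =
      OrderIso.addRight (n : ℝ) ''
        {t : ℝ | 0 ≤ t ∧ t ≤ (Module.finrank ℝ ℝ : ℝ) ∧ lowerSContent t F = 0} := by
    ext s
    simp only [finrank_euclideanSpace_fin, Module.finrank_self, Set.mem_image, Set.mem_ofPred_eq,
      OrderIso.addRight_apply, Nat.cast_add, Nat.cast_one]
    constructor
    · rintro ⟨-, hs1, hs⟩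
      have hns := le_of_lowerSContent_prodUnitCube_eq_zero hF hne hs
      refine ⟨s - n, ⟨by linarith, by linarith, ?_⟩, by ring⟩
      rw [← lowerSContent_prodUnitCube_eq_zero_iff (n := n) hF hne (by linarith) (by linarith)]
      simpa using hs
    · rintro ⟨t, ⟨ht0, ht1, ht⟩, rfl⟩
      exact ⟨by positivity, by linarith,
        (lowerSContent_prodUnitCube_eq_zero_iff hF hne ht0 ht1).2 ht⟩
  have h := (OrderIso.addRight (n : ℝ)).map_csInf'
    (s := {t : ℝ | 0 ≤ t ∧ t ≤ (Module.finrank ℝ ℝ : ℝ) ∧ lowerSContent t F = 0})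
    ⟨1, by simp, by simp, by simp [lowerSContent]⟩ ⟨0, fun t ht => ht.1⟩
  simp only [lowerSDim, Nat.succ_eq_add_one]
  rw [himage, ← h]
  simp
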